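/- Let $\mathbb D$ be the open unit disc. Let $(\phi_t)_{t\ge 0}$ be a semigroup of holomorphic self-maps of $\mathbb D$ (that is, $\phi_0=\mathrm{id}$, $\phi_{s+t}=\phi_s\circ\phi_t$, and $t\mapsto\phi_t$ is continuous for uniform convergence on compacta), and let $G:\mathbb D\to\mathbb C$, $G\not\equiv 0$, be its infinitesimal generator, i.e. the holomorphic function with $\partial_t\phi_t(z)=G(\phi_t(z))$ for all $t\ge0$, $z\in\mathbb D$. Let $\tau\in\overline{\mathbb D}$ be the Denjoy-Wolff point of $(\phi_t)$, i.e. $\phi_t\to\tau$ uniformly on compacta as $t\to\infty$, or, if $(\phi_t)$ is a group of elliptic automorphisms, $\tau\in\mathbb D$ is its common fixed point. Let $G(z)=(\tau-z)(1-\bar\tau z)p(z)$, with $p:\mathbb D\to\mathbb C$ holomorphic and $\operatorname{Re}p\ge0$, be the Berkson-Porta decomposition of $G$, and let $$\hat G(z):=(\tau-z)(1-\bar\tau z)\frac1{p(z)}$$ be the dual infinitesimal generator. A point $x\in\partial\mathbb D$ is called a boundary regular null point of $G$ with dilation $\ell\in\mathbb R$ if $\angle\lim_{z\to x}G(z)/(z-x)=\ell$,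 and a regular pole of $\hat G$ of mass $C>0$ if $\angle\liminf_{z\to x}|\hat G(z)(x-z)|=C$, where $\angle$ refers to non-tangential approach. Let $x\in\partial\mathbb D\setminus\{\tau\}$. If $x$ is a boundary regular null point of $G$ with dilation $\ell$, then $\ell>0$ and $\ell=\lim_{r\to1^-}|G(rx)|/(1-r)$. Moreover, for every $\ell>0$ the following are equivalent: 1. $x$ is a boundary regular null point of $G$ with dilation $\ell$; 2. $x$ is a regular pole of $\hat G$ of mass $|\tau-x|^4/\ell$. -/

import Mathlib

open Set Filter Topology Metric ComplexConjugate

/-- A semigroup `(φ_t)_{t ≥ 0}` of holomorphic self-maps of the unit disc `𝔻 = ball 0 1`: a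
homomorphism from `([0, ∞), +)` to `(Hol(𝔻, 𝔻), ∘)` that is continuous for the topology of uniform
convergence on compacta. Only the values `φ t z` with `0 ≤ t` and `z ∈ 𝔻` are meaningful. -/
structure IsHolSemigroup (φ : ℝ → ℂ → ℂ) : Prop where
  mapsTo : ∀ t, 0 ≤ t → MapsTo (φ t) (ball 0 1) (ball 0 1)
  holomorphic : ∀ t, 0 ≤ t → DifferentiableOn ℂ (φ t) (ball 0 1)
  zero : ∀ z ∈ ball (0 : ℂ) 1, φ 0 z = z
  add : ∀ s t, 0 ≤ s → 0 ≤ t → ∀ z ∈ ball (0 : ℂ) 1, φ (s + t) z = φ s (φ t z)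
  continuous : ∀ t, 0 ≤ t → TendstoLocallyUniformlyOn φ (φ t) (𝓝[Ici 0] t) (ball 0 1)

/-- `G` is the infinitesimal generator of `(φ_t)`: `G` is holomorphic in the unit disc and
`∂φ_t(z)/∂t = G(φ_t(z))` for all `t ≥ 0` and all `z` in the disc (one-sided derivative at `0`). -/
structure IsGeneratorOf (G : ℂ → ℂ) (φ : ℝ → ℂ → ℂ) : Prop where
  holomorphic : DifferentiableOn ℂ G (ball 0 1)
  hasDeriv : ∀ t, 0 ≤ t → ∀ z ∈ ball (0 : ℂ) 1,
    HasDerivWithinAt (fun s => φ s z) (G (φ t z)) (Ici 0) t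

/-- `τ` is the Denjoy-Wolff point of the (non-trivial) semigroup `(φ_t)`: a point of the closed
disc to which `φ_t` converges uniformly on compacta as `t → ∞`; for groups of elliptic
automorphisms, which do not converge, it is the common fixed point in the disc. (A common fixed
point in the disc of a semigroup which is not such a group is automatically the limit.) -/
def IsDenjoyWolffPoint (φ : ℝ → ℂ → ℂ) (τ : ℂ) : Prop :=
  τ ∈ closedBall (0 : ℂ) 1 ∧
    (TendstoLocallyUniformlyOn φ (fun _ => τ) atTop (ball 0 1) ∨
      (τ ∈ ball (0 : ℂ) 1 ∧ ∀ t, 0 ≤ t → φ t τ = τ))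

/-- `p` is the function in the Berkson-Porta decomposition `G(z) = (τ - z)(1 - τ̄ z) p(z)`. -/
structure IsBerksonPortaFactor (G : ℂ → ℂ) (τ : ℂ) (p : ℂ → ℂ) : Prop where
  holomorphic : DifferentiableOn ℂ p (ball 0 1)
  re_nonneg : ∀ z ∈ ball (0 : ℂ) 1, 0 ≤ (p z).re
  eq : ∀ z ∈ ball (0 : ℂ) 1, G z = (τ - z) * (1 - conj τ * z) * p z

/-- The function `p` of the Berkson-Porta decomposition of `G` with respect to `τ`; there is at most
one on the disc, and it exists if `G` is a generator with Denjoy-Wolff point `τ`. -/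
noncomputable def berksonPortaFactor (G : ℂ → ℂ) (τ : ℂ) : ℂ → ℂ :=
  Classical.epsilon fun p => IsBerksonPortaFactor G τ p

/-- The dual infinitesimal generator `Ĝ(z) = (τ - z)(1 - τ̄ z) / p(z)` of a generator `G` with
Denjoy-Wolff point `τ`. -/
noncomputable def dualGenerator (G : ℂ → ℂ) (τ : ℂ) (z : ℂ) : ℂ :=
  (τ - z) * (1 - conj τ * z) * (1 / berksonPortaFactor G τ z)

/-- The Stolz region `{z ∈ 𝔻 : |x - z| < M (1 - |z|)}` with vertex `x` and amplitude `M`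
(empty for `M ≤ 1`). -/
noncomputable def stolzRegion (x : ℂ) (M : ℝ) : Set ℂ :=
  {z | z ∈ ball (0 : ℂ) 1 ∧ ‖x - z‖ < M * (1 - ‖z‖)}

/-- The filter of non-tangential approach to the boundary point `x`: a property holds eventually
iff, for every `M`, it holds at all points of the Stolz region of amplitude `M` close to `x`. -/
noncomputable def angularNhds (x : ℂ) : Filter ℂ :=
  ⨆ M : ℝ, 𝓝[stolzRegion x M] x

/-- `x ∈ ∂𝔻` is a boundary regular null point of `G` with dilation `ℓ ∈ ℝ`:
`∠lim_{z → x} G(z) / (z - x) = ℓ`. -/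
def IsBoundaryRegularNullPoint (G : ℂ → ℂ) (x : ℂ) (ℓ : ℝ) : Prop :=
  x ∈ sphere (0 : ℂ) 1 ∧ Tendsto (fun z => G z / (z - x)) (angularNhds x) (𝓝 (ℓ : ℂ))

/-- `x ∈ ∂𝔻` is a regular pole of `G` of mass `C > 0`: `∠liminf_{z → x} |G(z) (x - z)| = C`
(the lower limit is taken in `[0, ∞]`). -/
def IsRegularPole (G : ℂ → ℂ) (x : ℂ) (C : ℝ) : Prop :=
  x ∈ sphere (0 : ℂ) 1 ∧ 0 < C ∧
    liminf (fun z => ‖G z * (x - z)‖ₑ) (angularNhds x) = ENNReal.ofReal C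

/-! Both conditions are read off from one angular limit. Since `1 / p` has nonnegative real part,
the Julia-Wolff-Carathéodory theorem `exists_tendsto_angularNhds` gives `(x - z) / p z → m * x` with
`m ≥ 0`, while `(τ - z) * (1 - conj τ * z) → -K * x` with `K = ‖τ - x‖ ^ 2 > 0`. Dividing or
multiplying these limits, `x` is a null point of dilation `ℓ` exactly when `ℓ * m = K`, and `‖Ĝ z *
(x - z)‖ → K * m`; mass `K ^ 2 / ℓ` therefore means `m = K / ℓ`, the same equation.

The angular limit comes from subtracting from `q` the largest multiple of the Herglotz kernel `(x +
z) / (x - z)` that keeps the real part nonnegative; a Schwarz-Pick bound makes the remainder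
negligible. The existence of `p` is the Berkson-Porta theorem, obtained by differentiating at `t =
0` the Schwarz-Pick inequality (interior `τ`) or Wolff's lemma (boundary `τ`). -/

/-! ### Schwarz-Pick inequalities in the disc and half-plane. -/

theorem norm_sq_one_sub_conj_mul (a z : ℂ) :
    ‖1 - conj a * z‖ ^ 2 = ‖z - a‖ ^ 2 + (1 - ‖a‖ ^ 2) * (1 - ‖z‖ ^ 2) := by
  simp only [Complex.sq_norm, Complex.normSq_apply, Complex.sub_re, Complex.sub_im,
    Complex.mul_re, Complex.mul_im, Complex.conj_re, Complex.conj_im, Complex.one_re,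
    Complex.one_im]
  ring

theorem norm_sq_add_conj (a z : ℂ) :
    ‖z + conj a‖ ^ 2 = ‖z - a‖ ^ 2 + 4 * z.re * a.re := by
  simp only [Complex.sq_norm, Complex.normSq_apply, Complex.sub_re, Complex.sub_im,
    Complex.add_re, Complex.add_im, Complex.conj_re, Complex.conj_im]
  ring

theorem norm_sq_lt_one {z : ℂ} (hz : z ∈ ball (0 : ℂ) 1) : ‖z‖ ^ 2 < 1 := by
  rw [mem_ball_zero_iff] at hz
  nlinarith [norm_nonneg z]

theorem one_sub_conj_mul_ne_zero {a z : ℂ} (ha : ‖a‖ ≤ 1) (hz : z ∈ ball (0 : ℂ) 1) :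
    1 - conj a * z ≠ 0 := by
  rw [mem_ball_zero_iff] at hz
  intro h
  have h1 : ‖conj a * z‖ = 1 := by rw [← sub_eq_zero.1 h, norm_one]
  rw [norm_mul, RCLike.norm_conj] at h1
  nlinarith [norm_nonneg z, norm_nonneg a]

theorem norm_sub_lt_norm_one_sub_conj_mul {a z : ℂ} (ha : a ∈ ball (0 : ℂ) 1)
    (hz : z ∈ ball (0 : ℂ) 1) : ‖z - a‖ < ‖1 - conj a * z‖ := by
  refine lt_of_pow_lt_pow_left₀ 2 (norm_nonneg _) ?_
  rw [norm_sq_one_sub_conj_mul]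
  linarith [mul_pos (sub_pos.2 (norm_sq_lt_one ha)) (sub_pos.2 (norm_sq_lt_one hz))]

/-- The Schwarz lemma for a zero at an arbitrary point of the disc. -/
theorem norm_mul_norm_le_of_eq_zero {g : ℂ → ℂ} (hd : DifferentiableOn ℂ g (ball 0 1))
    (hm : ∀ z ∈ ball (0 : ℂ) 1, ‖g z‖ ≤ 1) {a z : ℂ} (ha : a ∈ ball (0 : ℂ) 1)
    (hz : z ∈ ball (0 : ℂ) 1) (h0 : g a = 0) : ‖g z‖ * ‖1 - conj a * z‖ ≤ ‖z - a‖ := by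
  have han : ‖-a‖ ≤ 1 := by rw [norm_neg]; exact (mem_ball_zero_iff.1 ha).le
  have hne : ∀ w ∈ ball (0 : ℂ) 1, 1 + conj a * w ≠ 0 := fun w hw => by
    have := one_sub_conj_mul_ne_zero han hw
    simpa using this
  -- This disc automorphism sends `0` to `a`, which reduces to the Schwarz lemma at the origin.
  have hψ : MapsTo (fun w : ℂ => (w + a) / (1 + conj a * w)) (ball 0 1) (ball 0 1) := by
    intro w hw
    have hn : -a ∈ ball (0 : ℂ) 1 := by simpa using ha
    have := norm_sub_lt_norm_one_sub_conj_mul hn hw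
    rw [mem_ball_zero_iff, norm_div, div_lt_one (norm_pos_iff.2 (hne w hw))]
    simpa using this
  have hza := one_sub_conj_mul_ne_zero (mem_ball_zero_iff.1 ha).le hz
  have hw : ‖(z - a) / (1 - conj a * z)‖ < 1 := by
    rw [norm_div, div_lt_one (norm_pos_iff.2 hza)]
    exact norm_sub_lt_norm_one_sub_conj_mul ha hz
  have hw' := hne _ (mem_ball_zero_iff.2 hw)
  have hback : ((z - a) / (1 - conj a * z) + a) / (1 + conj a * ((z - a) / (1 - conj a * z)))
      = z := by
    rw [div_eq_iff hw']
    linear_combination div_mul_cancel₀ (z - a) hza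
  have key := Complex.norm_le_norm_of_mapsTo_ball (R := 1)
    (f := g ∘ fun w : ℂ => (w + a) / (1 + conj a * w))
    (hd.comp (fun w hw => ((differentiableAt_id.add_const a).div
      ((differentiableAt_id.const_mul (conj a)).const_add 1)
        (hne w hw)).differentiableWithinAt) hψ)
    (fun w hw => mem_closedBall_zero_iff.2 (hm _ (hψ hw))) (by simp [h0]) hw
  rw [Function.comp_apply, hback, norm_div, le_div_iff₀ (norm_pos_iff.2 hza)] at key
  exact key

/-- The **Schwarz-Pick lemma** for self-maps of the disc. -/
theorem schwarzPick_disc {f : ℂ → ℂ} (hd : DifferentiableOn ℂ f (ball 0 1))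
    (hm : MapsTo f (ball 0 1) (ball 0 1)) {a z : ℂ} (ha : a ∈ ball (0 : ℂ) 1)
    (hz : z ∈ ball (0 : ℂ) 1) :
    ‖f z - f a‖ * ‖1 - conj a * z‖ ≤ ‖z - a‖ * ‖1 - conj (f a) * f z‖ := by
  have hne : ∀ w ∈ ball (0 : ℂ) 1, 1 - conj (f a) * f w ≠ 0 := fun w hw =>
    one_sub_conj_mul_ne_zero (mem_ball_zero_iff.1 (hm ha)).le (hm hw)
  have := norm_mul_norm_le_of_eq_zero
    (g := fun w => (f w - f a) / (1 - conj (f a) * f w))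
    ((hd.sub_const _).div ((hd.const_mul _).const_sub _) hne)
    (fun w hw => by
      rw [norm_div, div_le_one (norm_pos_iff.2 (hne w hw))]
      exact (norm_sub_lt_norm_one_sub_conj_mul (hm ha) (hm hw)).le) ha hz (by simp)
  rw [norm_div, div_mul_eq_mul_div, div_le_iff₀ (norm_pos_iff.2 (hne z hz))] at this
  exact this

/-- The Schwarz-Pick lemma in terms of horocyclic quantities. -/
theorem schwarzPick_disc_sq {f : ℂ → ℂ} (hd : DifferentiableOn ℂ f (ball 0 1))
    (hm : MapsTo f (ball 0 1) (ball 0 1)) {a z : ℂ} (ha : a ∈ ball (0 : ℂ) 1)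
    (hz : z ∈ ball (0 : ℂ) 1) :
    ‖1 - conj (f a) * f z‖ ^ 2 * ((1 - ‖a‖ ^ 2) * (1 - ‖z‖ ^ 2)) ≤
      ‖1 - conj a * z‖ ^ 2 * ((1 - ‖f a‖ ^ 2) * (1 - ‖f z‖ ^ 2)) := by
  have h := pow_le_pow_left₀ (by positivity) (schwarzPick_disc hd hm ha hz) 2
  rw [mul_pow, mul_pow] at h
  have h1 := norm_sq_one_sub_conj_mul a z
  have h2 := norm_sq_one_sub_conj_mul (f a) (f z)
  nlinarith

/-- The Schwarz lemma for the Cayley transform of `h` centred at `h a`, once squared, bounds `‖h z +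
conj (h a)‖ ^ 2` by a multiple of `(h z).re`; one factor cancels because `(h z).re ≤ ‖h z + conj (h
a)‖`. The outcome controls all of `h z`, not only its real part, by `(h a).re`. -/
theorem schwarzPick_halfPlane_of_pos {h : ℂ → ℂ} (hd : DifferentiableOn ℂ h (ball 0 1))
    (hre : ∀ z ∈ ball (0 : ℂ) 1, 0 < (h z).re) {a z : ℂ} (ha : a ∈ ball (0 : ℂ) 1)
    (hz : z ∈ ball (0 : ℂ) 1) :
    ‖h z + conj (h a)‖ * ((1 - ‖a‖ ^ 2) * (1 - ‖z‖ ^ 2)) ≤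
      4 * (h a).re * ‖1 - conj a * z‖ ^ 2 := by
  have hS : ∀ w, (h w).re + (h a).re ≤ ‖h w + conj (h a)‖ := fun w => by
    simpa using Complex.re_le_norm (h w + conj (h a))
  have hpos : ∀ w ∈ ball (0 : ℂ) 1, 0 < ‖h w + conj (h a)‖ := fun w hw =>
    (add_pos (hre w hw) (hre a ha)).trans_le (hS w)
  have hle := norm_mul_norm_le_of_eq_zero
    (g := fun w => (h w - h a) / (h w + conj (h a)))
    ((hd.sub_const _).div (hd.add_const _) fun w hw => norm_pos_iff.1 (hpos w hw))
    (fun w hw => by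
      rw [norm_div, div_le_one (hpos w hw)]
      refine le_of_sq_le_sq ?_ (norm_nonneg _)
      rw [norm_sq_add_conj]
      nlinarith [mul_pos (hre w hw) (hre a ha)]) ha hz (by simp)
  rw [norm_div, div_mul_eq_mul_div, div_le_iff₀ (hpos z hz)] at hle
  have h2 := pow_le_pow_left₀ (by positivity) hle 2
  rw [mul_pow, mul_pow] at h2
  have h3 := norm_sq_one_sub_conj_mul a z
  have h4 := norm_sq_add_conj (h a) (h z)
  have h5 : ‖h z + conj (h a)‖ ^ 2 * ((1 - ‖a‖ ^ 2) * (1 - ‖z‖ ^ 2)) ≤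
      4 * (h z).re * (h a).re * ‖1 - conj a * z‖ ^ 2 := by nlinarith
  have h6 : (h z).re * (4 * (h a).re * ‖1 - conj a * z‖ ^ 2) ≤
      ‖h z + conj (h a)‖ * (4 * (h a).re * ‖1 - conj a * z‖ ^ 2) := by
    have := (hre a ha).le
    gcongr
    linarith [hS z, hre a ha]
  refine le_of_mul_le_mul_left ?_ (hpos z hz)
  linarith

/-- The **Schwarz-Pick lemma** for holomorphic functions with nonnegative real part. -/
theorem schwarzPick_halfPlane {h : ℂ → ℂ} (hd : DifferentiableOn ℂ h (ball 0 1))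
    (hre : ∀ z ∈ ball (0 : ℂ) 1, 0 ≤ (h z).re) {a z : ℂ} (ha : a ∈ ball (0 : ℂ) 1)
    (hz : z ∈ ball (0 : ℂ) 1) :
    ‖h z + conj (h a)‖ * ((1 - ‖a‖ ^ 2) * (1 - ‖z‖ ^ 2)) ≤
      4 * (h a).re * ‖1 - conj a * z‖ ^ 2 := by
  -- Adding `δ > 0` makes the real part strictly positive; then `δ → 0`.
  have key : ∀ᶠ δ : ℝ in 𝓝[>] 0,
      ‖(h z + (δ : ℂ)) + conj (h a + (δ : ℂ))‖ * ((1 - ‖a‖ ^ 2) * (1 - ‖z‖ ^ 2)) ≤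
        4 * (h a + (δ : ℂ)).re * ‖1 - conj a * z‖ ^ 2 := by
    filter_upwards [self_mem_nhdsWithin] with δ hδ
    refine schwarzPick_halfPlane_of_pos (h := fun w => h w + (δ : ℂ)) (hd.add_const _)
      (fun w hw => ?_) ha hz
    have : 0 < δ := hδ
    have := hre w hw
    simp only [Complex.add_re, Complex.ofReal_re]
    linarith
  have hl : Tendsto (fun δ : ℝ =>
      ‖(h z + (δ : ℂ)) + conj (h a + (δ : ℂ))‖ * ((1 - ‖a‖ ^ 2) * (1 - ‖z‖ ^ 2))) (𝓝[>] 0)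
      (𝓝 (‖(h z + ((0 : ℝ) : ℂ)) + conj (h a + ((0 : ℝ) : ℂ))‖ *
        ((1 - ‖a‖ ^ 2) * (1 - ‖z‖ ^ 2)))) :=
    (Continuous.tendsto (by fun_prop) 0).mono_left nhdsWithin_le_nhds
  have hr : Tendsto (fun δ : ℝ => 4 * (h a + (δ : ℂ)).re * ‖1 - conj a * z‖ ^ 2) (𝓝[>] 0)
      (𝓝 (4 * (h a + ((0 : ℝ) : ℂ)).re * ‖1 - conj a * z‖ ^ 2)) :=
    (Continuous.tendsto (by fun_prop) 0).mono_left nhdsWithin_le_nhds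
  simpa using le_of_tendsto_of_tendsto hl hr key

/-- A holomorphic function with nonnegative real part that vanishes somewhere vanishes identically. -/
theorem eq_zero_of_re_nonneg_of_eq_zero {h : ℂ → ℂ} (hd : DifferentiableOn ℂ h (ball 0 1))
    (hre : ∀ z ∈ ball (0 : ℂ) 1, 0 ≤ (h z).re) {a z : ℂ} (ha : a ∈ ball (0 : ℂ) 1)
    (hz : z ∈ ball (0 : ℂ) 1) (h0 : h a = 0) : h z = 0 := by
  have h1 := schwarzPick_halfPlane hd hre ha hz
  have h2 := mul_pos (sub_pos.2 (norm_sq_lt_one ha)) (sub_pos.2 (norm_sq_lt_one hz))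
  simp only [h0, map_zero, add_zero, Complex.zero_re, mul_zero, zero_mul] at h1
  by_contra hne
  exact (mul_pos (norm_pos_iff.2 hne) h2).not_ge h1

/-! ### Angular limits of functions with nonnegative real part. -/

theorem re_cayley {x z : ℂ} (hx : ‖x‖ = 1) :
    ((x + z) / (x - z)).re = (1 - ‖z‖ ^ 2) / ‖x - z‖ ^ 2 := by
  have h : (x + z).re * (x - z).re + (x + z).im * (x - z).im = ‖x‖ ^ 2 - ‖z‖ ^ 2 := by
    simp only [Complex.sq_norm, Complex.normSq_apply, Complex.sub_re, Complex.sub_im,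
      Complex.add_re, Complex.add_im]
    ring
  rw [Complex.div_re, ← add_div, h, hx, Complex.normSq_eq_norm_sq, one_pow]

theorem norm_one_sub_conj_mul_of_norm_eq_one {a x : ℂ} (hx : ‖x‖ = 1) :
    ‖1 - conj a * x‖ = ‖x - a‖ := by
  rw [← sq_eq_sq₀ (norm_nonneg _) (norm_nonneg _), norm_sq_one_sub_conj_mul, hx]
  ring

/-- If `h` has nonnegative real part and the infimum of `Re h` relative to the Poisson kernel at `x`
vanishes, then `(x - z) h(z)` tends to `0` non-tangentially. -/
theorem tendsto_angularNhds_zero {h : ℂ → ℂ} (hd : DifferentiableOn ℂ h (ball 0 1))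
    (hre : ∀ z ∈ ball (0 : ℂ) 1, 0 ≤ (h z).re) {x : ℂ} (hx : ‖x‖ = 1)
    (hinf : ∀ ε > 0, ∃ a ∈ ball (0 : ℂ) 1, (h a).re < ε * ((1 - ‖a‖ ^ 2) / ‖x - a‖ ^ 2)) :
    Tendsto (fun z => (x - z) * h z) (angularNhds x) (𝓝 0) := by
  rw [angularNhds, tendsto_iSup]
  intro M
  rw [Metric.tendsto_nhds]
  intro η hη
  set N := max M 1 with hN
  have hN1 : 1 ≤ N := le_max_right _ _
  -- The final bound tends to `4 * N * ε` as `z → x`, because `‖1 - conj a * x‖ = ‖x - a‖` cancels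
  -- the Poisson denominator; this `ε` makes it `η / 2`.
  obtain ⟨a, ha, hlt⟩ := hinf (η / (8 * N)) (by positivity)
  have hxa : 0 < ‖x - a‖ := norm_pos_iff.2 fun he => by
    rw [mem_ball_zero_iff, ← sub_eq_zero.1 he, hx] at ha
    exact lt_irrefl _ ha
  have hcont : Tendsto (fun z : ℂ => 4 * N * (η / (8 * N)) * ‖1 - conj a * z‖ ^ 2 / ‖x - a‖ ^ 2 +
      ‖x - z‖ * ‖h a‖) (𝓝[stolzRegion x M] x)
      (𝓝 (4 * N * (η / (8 * N)) * ‖1 - conj a * x‖ ^ 2 / ‖x - a‖ ^ 2 + ‖x - x‖ * ‖h a‖)) :=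
    (Continuous.tendsto (by fun_prop) x).mono_left nhdsWithin_le_nhds
  have hval : 4 * N * (η / (8 * N)) * ‖1 - conj a * x‖ ^ 2 / ‖x - a‖ ^ 2 + ‖x - x‖ * ‖h a‖ < η := by
    rw [norm_one_sub_conj_mul_of_norm_eq_one hx, sub_self, norm_zero, zero_mul, add_zero]
    have : 4 * N * (η / (8 * N)) * ‖x - a‖ ^ 2 / ‖x - a‖ ^ 2 = η / 2 := by
      field_simp
      norm_num
    linarith
  filter_upwards [hcont.eventually (gt_mem_nhds hval), self_mem_nhdsWithin] with z hz hzS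
  obtain ⟨hzb, hzM⟩ := hzS
  have hz1 := mem_ball_zero_iff.1 hzb
  have h1 := schwarzPick_halfPlane hd hre ha hzb
  have hA := sub_pos.2 (norm_sq_lt_one ha)
  have h2 : ‖h z + conj (h a)‖ * (1 - ‖z‖ ^ 2) ≤
      4 * (η / (8 * N)) * ‖1 - conj a * z‖ ^ 2 / ‖x - a‖ ^ 2 := by
    refine le_of_mul_le_mul_left ?_ hA
    have h3 : 4 * (h a).re * ‖1 - conj a * z‖ ^ 2 ≤
        4 * (η / (8 * N) * ((1 - ‖a‖ ^ 2) / ‖x - a‖ ^ 2)) * ‖1 - conj a * z‖ ^ 2 := by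
      gcongr
    calc _ = ‖h z + conj (h a)‖ * ((1 - ‖a‖ ^ 2) * (1 - ‖z‖ ^ 2)) := by ring
      _ ≤ _ := h1.trans h3
      _ = _ := by ring
  have h4 : ‖x - z‖ ≤ N * (1 - ‖z‖ ^ 2) := by
    have : M * (1 - ‖z‖) ≤ N * (1 - ‖z‖) :=
      mul_le_mul_of_nonneg_right (le_max_left _ _) (by linarith)
    have : N * (1 - ‖z‖) ≤ N * (1 - ‖z‖ ^ 2) := by
      gcongr
      nlinarith [norm_nonneg z]
    linarith
  rw [dist_zero_right]
  calc ‖(x - z) * h z‖ = ‖(x - z) * (h z + conj (h a)) - (x - z) * conj (h a)‖ := by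
        congr 1; ring
    _ ≤ ‖x - z‖ * ‖h z + conj (h a)‖ + ‖x - z‖ * ‖h a‖ := by
        refine (norm_sub_le _ _).trans ?_
        rw [norm_mul, norm_mul, RCLike.norm_conj]
    _ ≤ N * (‖h z + conj (h a)‖ * (1 - ‖z‖ ^ 2)) + ‖x - z‖ * ‖h a‖ := by
        have := mul_le_mul_of_nonneg_right h4 (norm_nonneg (h z + conj (h a)))
        linarith
    _ ≤ N * (4 * (η / (8 * N)) * ‖1 - conj a * z‖ ^ 2 / ‖x - a‖ ^ 2) + ‖x - z‖ * ‖h a‖ := by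
        gcongr
    _ = 4 * N * (η / (8 * N)) * ‖1 - conj a * z‖ ^ 2 / ‖x - a‖ ^ 2 + ‖x - z‖ * ‖h a‖ := by ring
    _ < η := hz

theorem tendsto_angularNhds_of_continuousAt {f : ℂ → ℂ} {x : ℂ} (hf : ContinuousAt f x) :
    Tendsto f (angularNhds x) (𝓝 (f x)) :=
  hf.tendsto.mono_left (iSup_le fun _ => nhdsWithin_le_nhds)

/-- The **Julia-Wolff-Carathéodory theorem** for functions with nonnegative real part. -/
theorem exists_tendsto_angularNhds {q : ℂ → ℂ} (hd : DifferentiableOn ℂ q (ball 0 1))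
    (hre : ∀ z ∈ ball (0 : ℂ) 1, 0 ≤ (q z).re) {x : ℂ} (hx : ‖x‖ = 1) :
    ∃ m : ℝ, 0 ≤ m ∧ Tendsto (fun z => (x - z) * q z) (angularNhds x) (𝓝 (m * x)) := by
  have hxz : ∀ z ∈ ball (0 : ℂ) 1, x - z ≠ 0 := fun z hz he => by
    rw [mem_ball_zero_iff, ← sub_eq_zero.1 he, hx] at hz
    exact lt_irrefl _ hz
  have hP : ∀ z ∈ ball (0 : ℂ) 1, 0 < (1 - ‖z‖ ^ 2) / ‖x - z‖ ^ 2 := fun z hz =>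
    div_pos (sub_pos.2 (norm_sq_lt_one hz)) (pow_pos (norm_pos_iff.2 (hxz z hz)) 2)
  set S : Set ℝ := (fun z => (q z).re / ((1 - ‖z‖ ^ 2) / ‖x - z‖ ^ 2)) '' ball 0 1 with hS
  have hS0 : ∀ s ∈ S, 0 ≤ s := by
    rintro _ ⟨z, hz, rfl⟩
    exact div_nonneg (hre z hz) (hP z hz).le
  have hSne : S.Nonempty := ⟨_, mem_image_of_mem _ (mem_ball_self one_pos)⟩
  set c := sInf S with hc
  have hc0 : 0 ≤ c := Real.sInf_nonneg hS0
  have hmul : ∀ z, ((c : ℂ) * ((x + z) / (x - z))).re = c * ((1 - ‖z‖ ^ 2) / ‖x - z‖ ^ 2) :=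
    fun z => by rw [Complex.re_ofReal_mul, re_cayley hx]
  -- The subtracted term has real part `c` times the Poisson kernel, so the new infimum is `0`.
  -- Multiplied by `x - z` it becomes `c * (x + z) → 2 * c * x`, whence `m = 2 * c`.
  have hlim := tendsto_angularNhds_zero (h := fun z => q z - (c : ℂ) * ((x + z) / (x - z)))
    (hd.sub (((differentiableOn_id.const_add x).div
      (differentiableOn_id.const_sub x) hxz).const_mul _))
    (fun z hz => by
      rw [Complex.sub_re, hmul, sub_nonneg, ← le_div_iff₀ (hP z hz)]
      exact csInf_le ⟨0, hS0⟩ (mem_image_of_mem _ hz)) hx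
    (fun ε hε => by
      obtain ⟨_, ⟨a, ha, rfl⟩, hlt⟩ := exists_lt_of_csInf_lt hSne (show sInf S < c + ε by linarith)
      refine ⟨a, ha, ?_⟩
      rw [div_lt_iff₀ (hP a ha)] at hlt
      rw [Complex.sub_re, hmul]
      linarith)
  refine ⟨2 * c, by positivity, ?_⟩
  have hsum := hlim.add (tendsto_angularNhds_of_continuousAt (x := x)
    (f := fun z => (c : ℂ) * (x + z)) (by fun_prop))
  have hval : (0 : ℂ) + c * (x + x) = ((2 * c : ℝ) : ℂ) * x := by push_cast; ring
  rw [hval] at hsum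
  refine hsum.congr' ?_
  rw [angularNhds, EventuallyEq, eventually_iSup]
  intro M
  filter_upwards [self_mem_nhdsWithin] with z hz
  have := hxz z hz.1
  field_simp
  ring

/-! ### The Berkson-Porta decomposition. -/

theorem HasDerivWithinAt.nonpos_of_forall_le {F : ℝ → ℝ} {F' : ℝ}
    (hF : HasDerivWithinAt F F' (Ici 0) 0) (hle : ∀ t, 0 ≤ t → F t ≤ F 0) : F' ≤ 0 := by
  rw [hasDerivWithinAt_iff_tendsto_slope] at hF
  have hs : Ici (0 : ℝ) \ {0} = Ioi 0 := Ici_sdiff_left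
  rw [hs] at hF
  refine le_of_tendsto hF ?_
  filter_upwards [self_mem_nhdsWithin] with t ht
  have ht : 0 < t := ht
  rw [slope_def_field, sub_zero]
  exact div_nonpos_of_nonpos_of_nonneg (by linarith [hle t ht.le]) ht.le

theorem IsGeneratorOf.hasDerivWithinAt_zero {G : ℂ → ℂ} {φ : ℝ → ℂ → ℂ} (hG : IsGeneratorOf G φ)
    (hφ : IsHolSemigroup φ) {z : ℂ} (hz : z ∈ ball (0 : ℂ) 1) :
    HasDerivWithinAt (fun s => φ s z) (G z) (Ici 0) 0 := by
  have := hG.hasDeriv 0 le_rfl z hz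
  rwa [hφ.zero z hz] at this

/-- A limit point of the orbits inside the disc is a common fixed point. -/
theorem IsHolSemigroup.apply_eq_of_tendsto {φ : ℝ → ℂ → ℂ} (hφ : IsHolSemigroup φ) {τ : ℂ}
    (hτ : τ ∈ ball (0 : ℂ) 1) (hlim : Tendsto (fun t => φ t 0) atTop (𝓝 τ)) {s : ℝ} (hs : 0 ≤ s) :
    φ s τ = τ := by
  have h0 : (0 : ℂ) ∈ ball (0 : ℂ) 1 := mem_ball_self one_pos
  have h1 : Tendsto (fun t => φ s (φ t 0)) atTop (𝓝 (φ s τ)) :=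
    (((hφ.holomorphic s hs).continuousOn.continuousAt
      (isOpen_ball.mem_nhds hτ)).tendsto).comp hlim
  have h2 : Tendsto (fun t => φ (s + t) 0) atTop (𝓝 τ) :=
    hlim.comp (tendsto_atTop_add_const_left _ s tendsto_id)
  refine tendsto_nhds_unique h1 (h2.congr' ?_)
  filter_upwards [eventually_ge_atTop 0] with t ht
  exact hφ.add s t hs ht 0 h0

/-- A holomorphic function on the disc whose real part is nonnegative off a point has nonnegative
real part. -/
theorem re_nonneg_of_forall_ne {p : ℂ → ℂ} (hp : DifferentiableOn ℂ p (ball 0 1)) {τ : ℂ}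
    (h : ∀ z ∈ ball (0 : ℂ) 1, z ≠ τ → 0 ≤ (p z).re) : ∀ z ∈ ball (0 : ℂ) 1, 0 ≤ (p z).re := by
  intro z hz
  have hc : Tendsto (fun w => (p w).re) (𝓝[≠] z) (𝓝 (p z).re) :=
    (Complex.continuous_re.continuousAt.comp
      (hp.continuousOn.continuousAt (isOpen_ball.mem_nhds hz))).tendsto.mono_left
      nhdsWithin_le_nhds
  by_cases hzτ : z = τ
  · refine ge_of_tendsto hc ?_
    filter_upwards [self_mem_nhdsWithin, mem_nhdsWithin_of_mem_nhds (isOpen_ball.mem_nhds hz)]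
      with w hw hwb
    exact h w hwb (by rw [← hzτ]; exact hw)
  · exact h z hz hzτ

/-- The Berkson-Porta decomposition at an interior fixed point. -/
theorem exists_isBerksonPortaFactor_of_fixed {φ : ℝ → ℂ → ℂ} (hφ : IsHolSemigroup φ) {G : ℂ → ℂ}
    (hG : IsGeneratorOf G φ) {τ : ℂ} (hτ : τ ∈ ball (0 : ℂ) 1)
    (hfix : ∀ t, 0 ≤ t → φ t τ = τ) : ∃ p, IsBerksonPortaFactor G τ p := by
  have hτn := (mem_ball_zero_iff.1 hτ).le
  have hden : ∀ z ∈ ball (0 : ℂ) 1, 1 - conj τ * z ≠ 0 := fun z hz =>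
    one_sub_conj_mul_ne_zero hτn hz
  have hGτ : G τ = 0 := by
    refine (uniqueDiffOn_Ici (0 : ℝ) 0 self_mem_Ici).eq_deriv _
      (hG.hasDerivWithinAt_zero hφ hτ) ?_
    exact (hasDerivWithinAt_const (0 : ℝ) (Ici 0) τ).congr (fun t ht => hfix t ht)
      (hfix 0 le_rfl)
  have hdG : DifferentiableOn ℂ (dslope G τ) (ball 0 1) :=
    (Complex.differentiableOn_dslope (isOpen_ball.mem_nhds hτ)).2 hG.holomorphic
  have hdp : DifferentiableOn ℂ (fun z => -dslope G τ z / (1 - conj τ * z)) (ball 0 1) :=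
    hdG.neg.div ((differentiableOn_id.const_mul _).const_sub _) hden
  have heq : ∀ z ∈ ball (0 : ℂ) 1,
      G z = (τ - z) * (1 - conj τ * z) * (-dslope G τ z / (1 - conj τ * z)) := by
    intro z hz
    have h1 : (z - τ) * dslope G τ z = G z := by
      have := sub_smul_dslope G τ z
      rwa [hGτ, sub_zero, smul_eq_mul] at this
    have h2 := div_mul_cancel₀ (-dslope G τ z) (hden z hz)
    linear_combination (-(τ - z)) * h2 - h1
  -- The quantity differentiated below vanishes identically at `z = τ` and says nothing there;
  -- continuity fills in that point.
  refine ⟨_, hdp, re_nonneg_of_forall_ne (τ := τ) hdp fun z hz hzτ => ?_, heq⟩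
  set p := -dslope G τ z / (1 - conj τ * z) with hp
  have hGz := heq z hz
  rw [← hp] at hGz
  have hd0 := hden z hz
  have hφ0 := hG.hasDerivWithinAt_zero hφ hz
  have hφz := hφ.zero z hz
  have hM : HasDerivWithinAt (fun s => (φ s z - τ) / (1 - conj τ * φ s z))
      ((z - τ) / (1 - conj τ * z) * (-(1 - ‖τ‖ ^ 2 : ℝ) * p)) (Ici 0) 0 := by
    have := (hφ0.sub_const τ).div ((hφ0.const_mul (conj τ)).const_sub 1)
      (by rw [hφz]; exact hd0)
    refine this.congr_deriv ?_
    rw [hφz, hGz]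
    have hn : ((1 - ‖τ‖ ^ 2 : ℝ) : ℂ) = 1 - conj τ * τ := by
      rw [Complex.conj_mul']; push_cast; ring
    rw [hn, div_mul_eq_mul_div, div_eq_div_iff (pow_ne_zero 2 hd0) hd0]
    ring
  -- Schwarz-Pick at the fixed point: the pseudohyperbolic distance to `τ` never exceeds its initial
  -- value.
  have hF := hM.norm_sq.nonpos_of_forall_le fun t ht => by
    refine pow_le_pow_left₀ (norm_nonneg _) ?_ 2
    have h := schwarzPick_disc (hφ.holomorphic t ht) (hφ.mapsTo t ht) hτ hz
    rw [hfix t ht] at h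
    rw [norm_div, norm_div, hφz, div_le_div_iff₀ (norm_pos_iff.2 (hden _ (hφ.mapsTo t ht hz)))
      (norm_pos_iff.2 hd0)]
    exact h
  rw [hφz, Complex.inner, mul_comm _ ((starRingEnd ℂ) _)] at hF
  have hre : ((starRingEnd ℂ) ((z - τ) / (1 - conj τ * z)) *
      ((z - τ) / (1 - conj τ * z) * (-(1 - ‖τ‖ ^ 2 : ℝ) * p))).re =
      -(‖(z - τ) / (1 - conj τ * z)‖ ^ 2 * (1 - ‖τ‖ ^ 2) * p.re) := by
    rw [← mul_assoc, Complex.conj_mul']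
    rw [← Complex.ofReal_neg, ← Complex.ofReal_pow, Complex.re_ofReal_mul, Complex.re_ofReal_mul]
    ring
  rw [hre] at hF
  have hpos : 0 < ‖(z - τ) / (1 - conj τ * z)‖ ^ 2 * (1 - ‖τ‖ ^ 2) :=
    mul_pos (pow_pos (norm_pos_iff.2 (div_ne_zero (sub_ne_zero.2 hzτ) hd0)) 2)
      (sub_pos.2 (norm_sq_lt_one hτ))
  exact nonneg_of_mul_nonneg_right (by linarith) hpos

/-- A positive sequence tending to `0` infinitely often does not increase. -/
theorem frequently_succ_le_of_tendsto_zero {u : ℕ → ℝ} (hpos : ∀ n, 0 < u n)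
    (hlim : Tendsto u atTop (𝓝 0)) : ∃ᶠ n in atTop, u (n + 1) ≤ u n := by
  intro hev
  obtain ⟨N, hN⟩ := eventually_atTop.1 hev
  have hmono : ∀ n ≥ N, u N ≤ u n := fun n hn => by
    induction n, hn using Nat.le_induction with
    | base => exact le_rfl
    | succ n hn ih => exact ih.trans (not_le.1 (hN n hn)).le
  exact (hpos N).not_ge (ge_of_tendsto hlim (eventually_atTop.2 ⟨N, hmono⟩))

/-- **Wolff's lemma** for semigroups: horodiscs at a boundary limit point are invariant. -/
theorem IsHolSemigroup.horodisc_le {φ : ℝ → ℂ → ℂ} (hφ : IsHolSemigroup φ) {τ : ℂ}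
    (hτ : ‖τ‖ = 1) (hlim : Tendsto (fun t => φ t 0) atTop (𝓝 τ)) {s : ℝ} (hs : 0 < s) {z : ℂ}
    (hz : z ∈ ball (0 : ℂ) 1) :
    ‖τ - φ s z‖ ^ 2 * (1 - ‖z‖ ^ 2) ≤ ‖τ - z‖ ^ 2 * (1 - ‖φ s z‖ ^ 2) := by
  have h0 : (0 : ℂ) ∈ ball (0 : ℂ) 1 := mem_ball_self one_pos
  set w : ℕ → ℂ := fun n => φ (n * s) 0 with hw
  have hns : ∀ n : ℕ, 0 ≤ n * s := fun n => by positivity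
  have hwb : ∀ n, w n ∈ ball (0 : ℂ) 1 := fun n => hφ.mapsTo _ (hns n) h0
  have hwlim : Tendsto w atTop (𝓝 τ) :=
    hlim.comp (tendsto_natCast_atTop_atTop.atTop_mul_const hs)
  have hsucc : ∀ n, w (n + 1) = φ s (w n) := fun n => by
    rw [hw]
    simp only
    rw [← hφ.add s (n * s) hs.le (hns n) 0 h0]
    congr 1
    push_cast
    ring
  have hupos : ∀ n, 0 < 1 - ‖w n‖ ^ 2 := fun n => sub_pos.2 (norm_sq_lt_one (hwb n))
  have hulim : Tendsto (fun n => 1 - ‖w n‖ ^ 2) atTop (𝓝 0) := by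
    have := (hwlim.norm.pow 2).const_sub 1
    simpa [hτ] using this
  have hfreq : ∃ᶠ n in atTop, ‖1 - conj (w (n + 1)) * φ s z‖ ^ 2 * (1 - ‖z‖ ^ 2) ≤
      ‖1 - conj (w n) * z‖ ^ 2 * (1 - ‖φ s z‖ ^ 2) := by
    -- Schwarz-Pick for the pair `w n`, `z` carries the ratio of `1 - ‖w (n + 1)‖ ^ 2` to `1 - ‖w n‖
    -- ^ 2`; it is at most `1` infinitely often, which suffices for passing to the limit.
    refine (frequently_succ_le_of_tendsto_zero hupos hulim).mono fun n hn => ?_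
    have h := schwarzPick_disc_sq (hφ.holomorphic s hs.le) (hφ.mapsTo s hs.le) (hwb n) hz
    rw [← hsucc n] at h
    refine le_of_mul_le_mul_left ?_ (hupos n)
    have h1 := sub_pos.2 (norm_sq_lt_one (hφ.mapsTo s hs.le hz))
    have h2 : ‖1 - conj (w n) * z‖ ^ 2 * (1 - ‖φ s z‖ ^ 2) * (1 - ‖w (n + 1)‖ ^ 2) ≤
        ‖1 - conj (w n) * z‖ ^ 2 * (1 - ‖φ s z‖ ^ 2) * (1 - ‖w n‖ ^ 2) := by gcongr
    linarith
  have hc : ∀ v : ℂ, Continuous fun w : ℂ => ‖1 - conj w * v‖ ^ 2 := fun v => by fun_prop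
  have hl := ((((hc (φ s z)).tendsto τ).comp
    (hwlim.comp (tendsto_add_atTop_nat 1))).mul_const (1 - ‖z‖ ^ 2))
  have hr := (((hc z).tendsto τ).comp hwlim).mul_const (1 - ‖φ s z‖ ^ 2)
  have key := le_of_tendsto_of_tendsto_of_frequently hl hr hfreq
  have hflip : ∀ v : ℂ, ‖1 - conj τ * v‖ = ‖τ - v‖ := fun v => by
    rw [← norm_one_sub_conj_mul_of_norm_eq_one hτ, ← RCLike.norm_conj]
    simp [mul_comm]
  simpa only [hflip] using key

/-- The Berkson-Porta decomposition at a boundary Denjoy-Wolff point. -/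
theorem exists_isBerksonPortaFactor_of_boundary {φ : ℝ → ℂ → ℂ} (hφ : IsHolSemigroup φ)
    {G : ℂ → ℂ} (hG : IsGeneratorOf G φ) {τ : ℂ} (hτ : ‖τ‖ = 1)
    (hlim : Tendsto (fun t => φ t 0) atTop (𝓝 τ)) : ∃ p, IsBerksonPortaFactor G τ p := by
  have hne : ∀ z ∈ ball (0 : ℂ) 1, τ - z ≠ 0 := fun z hz he => by
    rw [mem_ball_zero_iff, ← sub_eq_zero.1 he, hτ] at hz
    exact lt_irrefl _ hz
  have hττ : conj τ * τ = 1 := by rw [Complex.conj_mul', hτ]; simp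
  refine ⟨fun z => τ * G z / (τ - z) ^ 2, ?_, fun z hz => ?_, fun z hz => ?_⟩
  · exact (hG.holomorphic.const_mul τ).div ((differentiableOn_id.const_sub τ).pow 2)
      fun z hz => pow_ne_zero 2 (hne z hz)
  · have hφ0 := hG.hasDerivWithinAt_zero hφ hz
    have hφz := hφ.zero z hz
    -- The real part of this Cayley transform is the horocyclic quantity that Wolff's lemma bounds
    -- below by its initial value; its derivative is twice the candidate `p`.
    have hu : HasDerivWithinAt (fun s => (τ + φ s z) / (τ - φ s z))
        (2 * (τ * G z / (τ - z) ^ 2)) (Ici 0) 0 := by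
      have := (hφ0.const_add τ).div (hφ0.const_sub τ) (by rw [hφz]; exact hne z hz)
      refine this.congr_deriv ?_
      rw [hφz]
      ring
    have hre : HasDerivWithinAt (fun s => -((τ + φ s z) / (τ - φ s z)).re)
        (-(2 * (τ * G z / (τ - z) ^ 2)).re) (Ici 0) 0 :=
      (Complex.reCLM.hasFDerivAt.comp_hasDerivWithinAt (0 : ℝ) hu).neg
    have hle := hre.nonpos_of_forall_le fun t ht => by
      rcases ht.eq_or_lt with rfl | ht'
      · exact le_rfl
      rw [neg_le_neg_iff, re_cayley hτ, re_cayley hτ, hφz, div_le_div_iff₀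
        (pow_pos (norm_pos_iff.2 (hne z hz)) 2)
        (pow_pos (norm_pos_iff.2 (hne _ (hφ.mapsTo t ht hz))) 2)]
      have := hφ.horodisc_le hτ hlim ht' hz
      linarith
    have h2 : (2 * (τ * G z / (τ - z) ^ 2)).re = 2 * (τ * G z / (τ - z) ^ 2).re := by
      rw [← Complex.ofReal_ofNat, Complex.re_ofReal_mul]
    linarith
  · have h1 : (1 - conj τ * z) * τ = τ - z := by linear_combination (-z) * hττ
    have h2 := hne z hz
    field_simp
    linear_combination (-(G z)) * h1

/-- The **Berkson-Porta theorem**: existence of the decomposition. -/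
theorem exists_isBerksonPortaFactor {φ : ℝ → ℂ → ℂ} (hφ : IsHolSemigroup φ) {G : ℂ → ℂ}
    (hG : IsGeneratorOf G φ) {τ : ℂ} (hτ : IsDenjoyWolffPoint φ τ) :
    ∃ p, IsBerksonPortaFactor G τ p := by
  obtain ⟨hmem, hlim | ⟨hb, hfix⟩⟩ := hτ
  · have hlim0 : Tendsto (fun t => φ t 0) atTop (𝓝 τ) := hlim.tendsto_at (mem_ball_self one_pos)
    rcases (mem_closedBall_zero_iff.1 hmem).lt_or_eq with hlt | heq
    · have hb := mem_ball_zero_iff.2 hlt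
      exact exists_isBerksonPortaFactor_of_fixed hφ hG hb
        fun t ht => hφ.apply_eq_of_tendsto hb hlim0 ht
    · exact exists_isBerksonPortaFactor_of_boundary hφ hG heq hlim0
  · exact exists_isBerksonPortaFactor_of_fixed hφ hG hb hfix

/-! ### Radial approach and comparison of `G` with its dual. -/

theorem tendsto_radial_angularNhds {x : ℂ} (hx : ‖x‖ = 1) :
    Tendsto (fun r : ℝ => (r : ℂ) * x) (𝓝[<] 1) (angularNhds x) := by
  -- On the radius `‖x - z‖ = 1 - ‖z‖`, so any amplitude above `1` would do.
  have h : Tendsto (fun r : ℝ => (r : ℂ) * x) (𝓝[<] 1) (𝓝[stolzRegion x 2] x) := by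
    refine tendsto_nhdsWithin_iff.2 ⟨?_, ?_⟩
    · have : Tendsto (fun r : ℝ => (r : ℂ) * x) (𝓝 1) (𝓝 (((1 : ℝ) : ℂ) * x)) :=
        Continuous.tendsto (by fun_prop) 1
      rw [Complex.ofReal_one, one_mul] at this
      exact this.mono_left nhdsWithin_le_nhds
    · filter_upwards [Ioo_mem_nhdsLT (show (0 : ℝ) < 1 from one_pos)] with r hr
      have h1 : ‖(r : ℂ) * x‖ = r := by
        rw [norm_mul, hx, mul_one, Complex.norm_real, Real.norm_of_nonneg hr.1.le]
      have h2 : ‖x - (r : ℂ) * x‖ = 1 - r := by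
        rw [show x - (r : ℂ) * x = ((1 - r : ℝ) : ℂ) * x by push_cast; ring, norm_mul, hx,
          mul_one, Complex.norm_real, Real.norm_of_nonneg (by linarith [hr.2])]
      refine ⟨by rw [mem_ball_zero_iff, h1]; exact hr.2, ?_⟩
      rw [h1, h2]
      linarith [hr.2]
  exact h.mono_right (le_iSup (fun M => 𝓝[stolzRegion x M] x) 2)

theorem angularNhds_neBot {x : ℂ} (hx : ‖x‖ = 1) : (angularNhds x).NeBot :=
  (tendsto_radial_angularNhds hx).neBot

theorem eventually_angularNhds_mem_ball (x : ℂ) : ∀ᶠ z in angularNhds x, z ∈ ball (0 : ℂ) 1 := by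
  rw [angularNhds, eventually_iSup]
  intro M
  filter_upwards [self_mem_nhdsWithin] with z hz using hz.1

/-- A single zero of `p` would force `p`, hence `G`, to vanish identically. This makes `1 / p`
holomorphic. -/
theorem IsBerksonPortaFactor.ne_zero {G : ℂ → ℂ} {τ : ℂ} {p : ℂ → ℂ}
    (hp : IsBerksonPortaFactor G τ p) (hG0 : ∃ z ∈ ball (0 : ℂ) 1, G z ≠ 0) :
    ∀ z ∈ ball (0 : ℂ) 1, p z ≠ 0 := by
  obtain ⟨w, hw, hGw⟩ := hG0
  intro z hz h0
  refine hGw ?_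
  rw [hp.eq w hw, eq_zero_of_re_nonneg_of_eq_zero hp.holomorphic hp.re_nonneg hz hw h0, mul_zero]

theorem sub_mul_one_sub_conj_mul {τ x : ℂ} (hx : ‖x‖ = 1) :
    (τ - x) * (1 - conj τ * x) = -((‖τ - x‖ ^ 2 : ℝ) : ℂ) * x := by
  have h1 : conj x * x = 1 := by rw [Complex.conj_mul', hx]; simp
  have h2 : ((‖τ - x‖ ^ 2 : ℝ) : ℂ) = (conj τ - conj x) * (τ - x) := by
    rw [← map_sub, Complex.conj_mul']; push_cast; rfl
  rw [h2]
  linear_combination (x - τ) * h1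

theorem proposition5p3 (φ : ℝ → ℂ → ℂ) (hφ : IsHolSemigroup φ)
    (G : ℂ → ℂ) (hG : IsGeneratorOf G φ) (hG0 : ∃ z ∈ ball (0 : ℂ) 1, G z ≠ 0)
    (τ : ℂ) (hτ : IsDenjoyWolffPoint φ τ)
    (x : ℂ) (hx : x ∈ sphere (0 : ℂ) 1) (hxτ : x ≠ τ) (ℓ : ℝ) :
    (IsBoundaryRegularNullPoint G x ℓ →
      0 < ℓ ∧ Tendsto (fun r : ℝ => ‖G (r * x)‖ / (1 - r)) (𝓝[<] 1) (𝓝 ℓ)) ∧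
    (0 < ℓ →
      (IsBoundaryRegularNullPoint G x ℓ ↔
        IsRegularPole (dualGenerator G τ) x (‖τ - x‖ ^ 4 / ℓ))) := by
  have hx1 : ‖x‖ = 1 := mem_sphere_zero_iff_norm.1 hx
  have hx0 : x ≠ 0 := norm_ne_zero_iff.1 (by rw [hx1]; exact one_ne_zero)
  have := angularNhds_neBot hx1
  have hp : IsBerksonPortaFactor G τ (berksonPortaFactor G τ) :=
    Classical.epsilon_spec (exists_isBerksonPortaFactor hφ hG hτ)
  set p := berksonPortaFactor G τ with hpdef
  have hp0 := hp.ne_zero hG0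
  obtain ⟨m, hm0, hm⟩ := exists_tendsto_angularNhds (q := fun z => 1 / p z)
    ((differentiableOn_const 1).div hp.holomorphic hp0)
    (fun z hz => by
      rw [one_div, Complex.inv_re]
      exact div_nonneg (hp.re_nonneg z hz) (Complex.normSq_nonneg _)) hx1
  set K : ℝ := ‖τ - x‖ ^ 2 with hK
  have hKpos : 0 < K := pow_pos (norm_pos_iff.2 (sub_ne_zero.2 hxτ.symm)) 2
  have hA : Tendsto (fun z => (τ - z) * (1 - conj τ * z)) (angularNhds x)
      (𝓝 (-(K : ℂ) * x)) := by
    rw [hK, ← sub_mul_one_sub_conj_mul hx1]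
    exact tendsto_angularNhds_of_continuousAt (f := fun z => (τ - z) * (1 - conj τ * z))
      (by fun_prop)
  have hxz : ∀ z ∈ ball (0 : ℂ) 1, x - z ≠ 0 := fun z hz he => by
    rw [mem_ball_zero_iff, ← sub_eq_zero.1 he, hx1] at hz
    exact lt_irrefl _ hz
  have hball := eventually_angularNhds_mem_ball x
  -- In the product of `G z / (z - x)` and `(x - z) / p z` the factor `p` cancels. Conversely `K >
  -- 0` forces `m ≠ 0`, so the limits may be divided.
  have hnull : IsBoundaryRegularNullPoint G x ℓ ↔ ℓ * m = K := by
    constructor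
    · rintro ⟨-, hlim⟩
      have h1 := (hlim.mul hm).congr' (f₂ := fun z => -((τ - z) * (1 - conj τ * z))) (by
        filter_upwards [hball] with z hz
        have h2 := hxz z hz
        have h3 := hp0 z hz
        rw [hp.eq z hz, ← neg_sub x z]
        field_simp)
      have h2 := tendsto_nhds_unique h1 hA.neg
      have h3 : ((ℓ * m : ℝ) : ℂ) = (K : ℂ) := by
        refine mul_right_cancel₀ hx0 ?_
        push_cast
        linear_combination h2
      exact_mod_cast h3
    · intro hℓ
      have hm0' : (m : ℂ) ≠ 0 := by
        rintro h
        rw [Complex.ofReal_eq_zero.1 h, mul_zero] at hℓ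
        exact hKpos.ne hℓ
      refine ⟨hx, ?_⟩
      have h1 := hA.neg.div hm (mul_ne_zero hm0' hx0)
      have h2 : -(-(K : ℂ) * x) / (m * x) = ℓ := by
        rw [← hℓ, div_eq_iff (mul_ne_zero hm0' hx0)]
        push_cast
        ring
      rw [h2] at h1
      refine h1.congr' ?_
      filter_upwards [hball] with z hz
      have h2 := hxz z hz
      have h3 := hp0 z hz
      rw [Pi.div_apply, hp.eq z hz, ← neg_sub x z]
      field_simp
  -- The lower limit is a genuine limit.
  have hpole : liminf (fun z => ‖dualGenerator G τ z * (x - z)‖ₑ) (angularNhds x) =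
      ENNReal.ofReal (K * m) := by
    have h1 : Tendsto (fun z => dualGenerator G τ z * (x - z)) (angularNhds x)
        (𝓝 (-(K : ℂ) * x * (m * x))) := by
      refine (hA.mul hm).congr fun z => ?_
      rw [dualGenerator, ← hpdef]
      ring
    rw [(h1.enorm).liminf_eq, ← ofReal_norm]
    congr 1
    simp [hx1, abs_of_nonneg hm0, abs_of_pos hKpos]
  refine ⟨fun hn => ?_, fun hℓ => ?_⟩
  · have hℓm := hnull.1 hn
    have hℓ : 0 < ℓ := by
      by_contra hneg
      nlinarith
    refine ⟨hℓ, ?_⟩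
    have h1 := (hn.2.comp (tendsto_radial_angularNhds hx1)).norm
    rw [Complex.norm_real, Real.norm_of_nonneg hℓ.le] at h1
    refine h1.congr' ?_
    filter_upwards [self_mem_nhdsWithin] with r hr
    have hr : r < 1 := hr
    rw [Function.comp_apply, norm_div,
      show (r : ℂ) * x - x = -(((1 - r : ℝ) : ℂ) * x) by push_cast; ring, norm_neg, norm_mul, hx1,
      mul_one, Complex.norm_real, Real.norm_of_nonneg (by linarith)]
  · have h4 : ‖τ - x‖ ^ 4 / ℓ = K * (K / ℓ) := by rw [hK]; ring
    have hpos : 0 < K * (K / ℓ) := by positivity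
    rw [hnull, IsRegularPole, hpole, h4,
      ENNReal.ofReal_eq_ofReal_iff (mul_nonneg hKpos.le hm0) hpos.le, mul_right_inj' hKpos.ne',
      eq_div_iff hℓ.ne', mul_comm]
    exact ⟨fun h => ⟨hx, hpos, h⟩, fun h => h.2.2⟩
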